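/- Let $F$ be a non-archimedean local field with ring of integers $R$, residue field of odd cardinality $q$, and let $\pi$ be a generator of the maximal ideal of $R$. Let $J$ be the $5\times 5$ matrix with $1$'s on the antidiagonal and $0$'s elsewhere, $Q(v,w)={}^tvJw$ on $V=F^5$ (columns), so that $Q(v,v)=2v_1v_5+2v_2v_4+v_3^2$. Let $G=SO(3,2;F)=\{g\in SL(5,F):{}^tgJg=J\}$, acting on $V$ by left multiplication, and let $K=SO(3,2;R)$ be the subgroup of elements of $G$ with entries in $R$. For $r\ge 0$ put $d_r=\mathrm{diag}(\pi^r,1,1,1,\pi^{-r})\in G$. Consider the following two cases. (Split case) $S=\{v\in V: Q(v,v)=1\}$ and $v_1={}^t(1/2,0,0,0,1)\in S$. (Non-split case) $\theta\in R^\times$ is a unit that is not a square in $F$, $S=\{v\in V:Q(v,v)=4\theta\}$ and $v_1={}^t(2\theta,0,0,1,1)\in S$. In either case let $ds$ be a $G$-invariant Borel measure on $S$ that is finite on compact sets, and let $\Lambda_r$ be the volume of the $K$-orbit $Kd_rv_1$ in $S$ with respect to $ds$. Then for every $r\ge 1$ $$\Lambda_r=q^{3r}(1-q^{-2})\,\Lambda_0\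 \text{ in the split case},\qquad \Lambda_r=q^{3r}(1+q^{-2})\,\Lambda_0\ \text{ in the non-split case}.$$ -/

import Mathlib

open scoped Matrix ValuativeRel
open MeasureTheory

namespace SO32

/-- The antidiagonal matrix `J = J₅`, with ones on the antidiagonal and zeros elsewhere. -/
def J (A : Type*) [CommRing A] : Matrix (Fin 5) (Fin 5) A :=
  Matrix.of fun i j => if j = i.rev then 1 else 0

/-- The form `Q(v, w) = ᵗv J w` on columns of length five. -/
def Q {A : Type*} [CommRing A] (v w : Fin 5 → A) : A := v ⬝ᵥ (J A *ᵥ w)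

/-- The special orthogonal group `SO(J)`: the `g` in `SL(5)` with `ᵗg J g = J`. -/
def G (A : Type*) [CommRing A] : Subgroup (Matrix.SpecialLinearGroup (Fin 5) A) where
  carrier := {g | (g : Matrix (Fin 5) (Fin 5) A)ᵀ * J A * (g : Matrix (Fin 5) (Fin 5) A) = J A}
  one_mem' := by simp
  mul_mem' := by
    intro a b ha hb
    simp only [Set.mem_ofPred_eq, Matrix.SpecialLinearGroup.coe_mul, Matrix.transpose_mul] at *
    calc _ = (b : Matrix (Fin 5) (Fin 5) A)ᵀ *
          ((a : Matrix (Fin 5) (Fin 5) A)ᵀ * J A * (a : Matrix (Fin 5) (Fin 5) A)) *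
          (b : Matrix (Fin 5) (Fin 5) A) := by simp only [Matrix.mul_assoc]
      _ = _ := by rw [ha, hb]
  inv_mem' := by
    intro a ha
    simp only [Set.mem_ofPred_eq] at *
    have h1 : (a : Matrix (Fin 5) (Fin 5) A) *
        ((a⁻¹ : Matrix.SpecialLinearGroup (Fin 5) A) : Matrix (Fin 5) (Fin 5) A) = 1 := by
      rw [← Matrix.SpecialLinearGroup.coe_mul, mul_inv_cancel, Matrix.SpecialLinearGroup.coe_one]
    have h2 := congrArg Matrix.transpose h1
    rw [Matrix.transpose_mul, Matrix.transpose_one] at h2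
    conv_lhs => rw [← ha]
    simp only [Matrix.mul_assoc]
    rw [h1, Matrix.mul_one, ← Matrix.mul_assoc, h2, Matrix.one_mul]

/-- The quadric `{v ; Q(v, v) = c}`. -/
def sphere {A : Type*} [CommRing A] (c : A) : Set (Fin 5 → A) := {v | Q v v = c}

theorem Q_mulVec {A : Type*} [CommRing A] (g : G A) (v w : Fin 5 → A) :
    Q ((g : Matrix.SpecialLinearGroup (Fin 5) A).1 *ᵥ v)
      ((g : Matrix.SpecialLinearGroup (Fin 5) A).1 *ᵥ w) = Q v w := by
  have hg : (g : Matrix.SpecialLinearGroup (Fin 5) A).1ᵀ * J A *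
      (g : Matrix.SpecialLinearGroup (Fin 5) A).1 = J A := g.2
  unfold Q
  conv_rhs => rw [← hg]
  rw [Matrix.mul_assoc, ← Matrix.mulVec_mulVec, ← Matrix.mulVec_mulVec,
    Matrix.dotProduct_mulVec v, Matrix.vecMul_transpose]

/-- `SO(J)` acts on each quadric by multiplication of columns on the left. -/
instance {A : Type*} [CommRing A] (c : A) : MulAction (G A) (sphere c) where
  smul g x := ⟨(g : Matrix.SpecialLinearGroup (Fin 5) A).1 *ᵥ x.1, (Q_mulVec g x.1 x.1).trans x.2⟩
  one_smul x := Subtype.ext (Matrix.one_mulVec x.1)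
  mul_smul g h x := Subtype.ext (Matrix.mulVec_mulVec x.1 g.1.1 h.1.1).symm

/-- The quadric over a topological ring carries the Borel sets of its subspace topology. -/
instance {A : Type*} [CommRing A] [TopologicalSpace A] (c : A) : MeasurableSpace (sphere c) :=
  borel _

instance {A : Type*} [CommRing A] [TopologicalSpace A] (c : A) : BorelSpace (sphere c) := ⟨rfl⟩

/-- The element `diag(a, 1, 1, 1, a⁻¹)` of `SO(J)`. -/
def diagElt {A : Type*} [CommRing A] (a : Aˣ) : G A :=
  ⟨⟨Matrix.diagonal ![(a : A), 1, 1, 1, ((a⁻¹ : Aˣ) : A)], by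
      simp [Matrix.det_diagonal, Fin.prod_univ_five]⟩, by
    change (Matrix.diagonal _)ᵀ * J A * Matrix.diagonal _ = J A
    ext i j
    rw [Matrix.diagonal_transpose, Matrix.mul_diagonal, Matrix.diagonal_mul]
    fin_cases i <;> fin_cases j <;> simp [J, Fin.rev, Fin.ext_iff]⟩

/-- The base point `ᵗ(1/2, 0, 0, 0, 1)` of the quadric `Q(v, v) = 1` (split case). -/
def v₁Split {F : Type*} [Field F] (h2 : (2 : F) ≠ 0) : sphere (1 : F) :=
  ⟨![1 / 2, 0, 0, 0, 1], by
    simp [sphere, Q, J, dotProduct, Matrix.mulVec, Fin.sum_univ_five, Fin.rev, Fin.ext_iff]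
    field_simp
    norm_num⟩

/-- The base point `ᵗ(2θ, 0, 0, 1, 1)` of the quadric `Q(v, v) = 4θ` (non-split case). -/
def v₁NonSplit {F : Type*} [Field F] (θ : F) : sphere (4 * θ) :=
  ⟨![2 * θ, 0, 0, 1, 1], by
    simp [sphere, Q, J, dotProduct, Matrix.mulVec, Fin.sum_univ_five, Fin.rev, Fin.ext_iff]
    ring⟩

section LocalField

variable (F : Type*) [Field F] [ValuativeRel F]

/-- The subgroup `K = SO(3,2; R)` of the elements of `G = SO(3,2; F)` that come from `SL(5, R)`,
`R` being the ring of integers of `F`. -/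
noncomputable def K : Subgroup (G F) :=
  (Matrix.SpecialLinearGroup.map (n := Fin 5) (𝒪[F]).subtype).range.subgroupOf (G F)

variable {F}

/-- The element `d_r = diag(π^r, 1, 1, 1, π^{-r})` of `G`. -/
noncomputable def d (ϖ : 𝒪[F]) (hϖ : Irreducible ϖ) (r : ℕ) : G F :=
  diagElt (Units.mk0 (ϖ : F) (fun h => hϖ.ne_zero (Subtype.ext h)) ^ r)

/-- The orbit `K d_r v` of `K` in the quadric. -/
noncomputable def orbit (ϖ : 𝒪[F]) (hϖ : Irreducible ϖ) {c : F} (v : sphere c) (r : ℕ) : Set (sphere c) :=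
  MulAction.orbit (K F) (d ϖ hϖ r • v)

theorem two_ne_zero_of_residue (h : ringChar 𝓀[F] ≠ 2) : (2 : F) ≠ 0 := by
  intro h2
  have h3 : (2 : 𝒪[F]) = 0 := Subtype.ext h2
  have h4 : (2 : 𝓀[F]) = 0 := by
    have := congrArg (IsLocalRing.residue 𝒪[F]) h3
    rwa [map_zero, map_ofNat] at this
  exact Ring.two_ne_zero h h4

end LocalField

end SO32

namespace SO32

section Form

variable {A : Type*} [CommRing A]

theorem Q_apply (v w : Fin 5 → A) :
    Q v w = v 0 * w 4 + v 1 * w 3 + v 2 * w 2 + v 3 * w 1 + v 4 * w 0 := by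
  simp [Q, J, dotProduct, Matrix.mulVec, Fin.sum_univ_five, Fin.rev, Fin.ext_iff]

theorem Q_smul_smul (a b : A) (v w : Fin 5 → A) : Q (a • v) (b • w) = a * b * Q v w := by
  simp only [Q_apply, Pi.smul_apply, smul_eq_mul]; ring

theorem Q_map {B : Type*} [CommRing B] (f : A →+* B) (v w : Fin 5 → A) :
    Q (f ∘ v) (f ∘ w) = f (Q v w) := by
  simp [Q_apply]

/-- The image of `g` under a ring homomorphism. -/
def mapG {B : Type*} [CommRing B] (f : A →+* B) (g : G A) : G B :=
  ⟨Matrix.SpecialLinearGroup.map f g.1, by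
    have hg : (g : Matrix.SpecialLinearGroup (Fin 5) A).1ᵀ * J A *
      (g : Matrix.SpecialLinearGroup (Fin 5) A).1 = J A := g.2
    have hJ : (J A).map f = J B := by
      ext i j
      simp [J, apply_ite f]
    have h := congrArg (fun M => Matrix.map M f) hg
    simp only [Matrix.map_mul, hJ] at h
    exact h⟩

theorem mapG_mulVec {B : Type*} [CommRing B] (f : A →+* B) (g : G A) (v : Fin 5 → A) :
    (mapG f g).1.1 *ᵥ (f ∘ v) = f ∘ (g.1.1 *ᵥ v) := by
  ext i
  exact (RingHom.map_mulVec f g.1.1 v i).symm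

theorem mul_mulVec (g h : G A) (v : Fin 5 → A) :
    (g * h).1.1 *ᵥ v = g.1.1 *ᵥ (h.1.1 *ᵥ v) :=
  (Matrix.mulVec_mulVec v g.1.1 h.1.1).symm

theorem inv_mulVec_mulVec (g : G A) (v : Fin 5 → A) :
    (g⁻¹).1.1 *ᵥ (g.1.1 *ᵥ v) = v := by
  rw [← mul_mulVec, inv_mul_cancel]
  exact Matrix.one_mulVec v

theorem mulVec_inv_mulVec (g : G A) (v : Fin 5 → A) :
    g.1.1 *ᵥ ((g⁻¹).1.1 *ᵥ v) = v := by
  rw [← mul_mulVec, mul_inv_cancel]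
  exact Matrix.one_mulVec v

theorem mulVec_injective (g : G A) : Function.Injective fun v : Fin 5 → A => g.1.1 *ᵥ v :=
  Function.LeftInverse.injective (inv_mulVec_mulVec g)

theorem transpose_mul_J_mul {M : Matrix (Fin 5) (Fin 5) A}
    (h : ∀ v w, Q (M *ᵥ v) (M *ᵥ w) = Q v w) : Mᵀ * J A * M = J A := by
  refine Matrix.ext_of_mulVec_single fun i => dotProduct_eq _ _ fun v => ?_
  have := h v (Pi.single i 1)
  unfold Q at this
  rw [dotProduct_comm, dotProduct_comm _ v, ← this, Matrix.mul_assoc, ← Matrix.mulVec_mulVec,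
    ← Matrix.mulVec_mulVec, Matrix.dotProduct_mulVec v, Matrix.vecMul_transpose]

/-- An even permutation of the coordinates that preserves `Q`, as an element of `SO(J)`. -/
def permElt (σ : Equiv.Perm (Fin 5)) (hs : Equiv.Perm.sign σ = 1)
    (hQ : ∀ v w : Fin 5 → A, Q (v ∘ σ) (w ∘ σ) = Q v w) : G A :=
  ⟨⟨σ.permMatrix A, by rw [Matrix.det_permutation, hs]; simp⟩,
    transpose_mul_J_mul fun v w => by rw [Matrix.permMatrix_mulVec, Matrix.permMatrix_mulVec, hQ]⟩

/-- The exchange of the two vectors of each hyperbolic pair, as an element of `SO(J)`. -/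
def swapElt : G A :=
  permElt Fin.revPerm (by decide) fun v w => by
    simp [Q_apply, Fin.rev]; ring

theorem swapElt_mulVec (v : Fin 5 → A) :
    (swapElt : G A).1.1 *ᵥ v = ![v 4, v 3, v 2, v 1, v 0] := by
  refine (Matrix.permMatrix_mulVec Fin.revPerm).trans ?_
  ext i
  fin_cases i <;> rfl

/-- The exchange of the two hyperbolic pairs, as an element of `SO(J)`. -/
def planeSwapElt : G A :=
  permElt (Equiv.swap 0 1 * Equiv.swap 3 4) (by decide) fun v w => by
    simp [Q_apply, Equiv.swap_apply_def]; ring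

theorem planeSwapElt_mulVec (v : Fin 5 → A) :
    (planeSwapElt : G A).1.1 *ᵥ v = ![v 1, v 0, v 2, v 4, v 3] := by
  refine (Matrix.permMatrix_mulVec (Equiv.swap 0 1 * Equiv.swap 3 4)).trans ?_
  ext i
  fin_cases i <;> rfl

/-- The matrix of the Eichler transformation of the vector `(0, b, c, d, 0)`, `h` being one half. -/
def eichlerMatrix (h b c d : A) : Matrix (Fin 5) (Fin 5) A :=
  !![1, -d, -c, -b, -(b * d + h * c ^ 2); 0, 1, 0, 0, b; 0, 0, 1, 0, c; 0, 0, 0, 1, d;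
    0, 0, 0, 0, 1]

theorem eichlerMatrix_mulVec (h b c d : A) (v : Fin 5 → A) :
    eichlerMatrix h b c d *ᵥ v =
      ![v 0 - d * v 1 - c * v 2 - b * v 3 - (b * d + h * c ^ 2) * v 4,
        v 1 + b * v 4, v 2 + c * v 4, v 3 + d * v 4, v 4] := by
  ext i
  fin_cases i <;> simp [eichlerMatrix, Matrix.mulVec, dotProduct, Fin.sum_univ_five]
  ring

/-- The Eichler transformation of the vector `(0, b, c, d, 0)` as an element of `SO(J)`. -/
def eichlerElt {h : A} (h2 : 2 * h = 1) (b c d : A) : G A :=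
  ⟨⟨eichlerMatrix h b c d, by
      rw [Matrix.det_of_isUpperTriangular]
      · simp [eichlerMatrix, Fin.prod_univ_five]
      · intro i j hij
        fin_cases i <;> fin_cases j <;> simp [eichlerMatrix] at hij ⊢⟩,
    transpose_mul_J_mul fun v w => by
      simp only [eichlerMatrix_mulVec, Q_apply, Matrix.cons_val]
      linear_combination (-c ^ 2 * v 4 * w 4) * h2⟩

theorem diagElt_mulVec (a : Aˣ) (v : Fin 5 → A) :
    (diagElt a).1.1 *ᵥ v = ![a * v 0, v 1, v 2, v 3, ((a⁻¹ : Aˣ) : A) * v 4] := by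
  change Matrix.diagonal _ *ᵥ v = _
  ext i
  rw [Matrix.mulVec_diagonal]
  fin_cases i <;> simp

/-- The representative `(t, 0, 0, 0, 1)` of the primitive vectors of norm `2t`. -/
def normalForm (t : A) : Fin 5 → A := ![t, 0, 0, 0, 1]

theorem exists_mulVec_eq_normalForm_of_isUnit {h : A} (h2 : 2 * h = 1) {v : Fin 5 → A}
    (hv : IsUnit (v 4)) {t : A} (ht : 2 * t = Q v v) : ∃ g : G A, g.1.1 *ᵥ v = normalForm t := by
  obtain ⟨a, ha⟩ := hv
  refine ⟨eichlerElt h2 (-v 1) (-v 2) (-v 3) * diagElt a, ?_⟩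
  have ha' : ((a⁻¹ : Aˣ) : A) * v 4 = 1 := by rw [← ha]; simp
  rw [mul_mulVec, diagElt_mulVec]
  refine (eichlerMatrix_mulVec _ _ _ _ _).trans ?_
  have hq : v 4 * v 0 - t + v 1 * v 3 + h * v 2 ^ 2 = 0 := by
    rw [Q_apply] at ht
    linear_combination (-h) * ht + (t - v 1 * v 3 - v 4 * v 0) * h2
  ext i
  fin_cases i <;> simp [normalForm, ha', ha]
  linear_combination hq - v 2 ^ 2 * h2

theorem exists_mulVec_isUnit [IsLocalRing A] {h : A} (h2 : 2 * h = 1) {v : Fin 5 → A} {i : Fin 5}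
    (hv : IsUnit (v i)) : ∃ g : G A, IsUnit ((g.1.1 *ᵥ v) 4) := by
  by_cases h4 : IsUnit (v 4)
  · exact ⟨1, by rwa [show ((1 : G A).1.1 *ᵥ v) = v from Matrix.one_mulVec v]⟩
  by_cases h0 : IsUnit (v 0)
  · exact ⟨swapElt, by simpa [swapElt_mulVec] using h0⟩
  by_cases h3 : IsUnit (v 3)
  · exact ⟨planeSwapElt, by simpa [planeSwapElt_mulVec] using h3⟩
  by_cases h1 : IsUnit (v 1)
  · exact ⟨swapElt * planeSwapElt, by
      rw [mul_mulVec]; simpa [swapElt_mulVec, planeSwapElt_mulVec] using h1⟩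
  have hv2 : IsUnit (v 2) := by fin_cases i <;> simp_all
  refine ⟨swapElt * eichlerElt h2 0 1 0, ?_⟩
  have hE : (eichlerElt h2 0 1 0).1.1 *ᵥ v = _ := eichlerMatrix_mulVec _ _ _ _ _
  rw [mul_mulVec, hE, swapElt_mulVec]
  by_contra hc
  simp only [Matrix.cons_val] at hc
  rw [← mem_nonunits_iff, ← IsLocalRing.mem_maximalIdeal] at *
  have := Ideal.sub_mem _ (Ideal.sub_mem _ h0 hc) (Ideal.mul_mem_left _ h h4)
  rw [IsLocalRing.mem_maximalIdeal] at this
  refine this ?_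
  convert hv2 using 1
  ring

/-- Over a local ring in which two is invertible, every primitive vector is equivalent to its
normal form. -/
theorem exists_mulVec_eq_normalForm [IsLocalRing A] {h : A} (h2 : 2 * h = 1) {v : Fin 5 → A}
    {i : Fin 5} (hv : IsUnit (v i)) {t : A} (ht : 2 * t = Q v v) :
    ∃ g : G A, g.1.1 *ᵥ v = normalForm t := by
  obtain ⟨g, hg⟩ := exists_mulVec_isUnit h2 hv
  obtain ⟨g', hg'⟩ := exists_mulVec_eq_normalForm_of_isUnit h2 hg (t := t)
    (by rw [ht, Q_mulVec])
  exact ⟨g' * g, by rw [mul_mulVec, hg']⟩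

end Form

section Count

variable {k : Type*} [Field k] [Finite k]

theorem card_hyperbola (h2 : (2 : k) ≠ 0) (t : k) [Decidable (t = 0)] :
    Nat.card {p : k × k // 2 * p.1 * p.2 = t} + 1 =
      Nat.card k + if t = 0 then Nat.card k else 0 := by
  classical
  have := Fintype.ofFinite k
  have h (a : k) : (∑ b : k, if 2 * a * b = t then 1 else 0) + (if a = 0 then 1 else 0) =
      1 + if a = 0 then (if t = 0 then Nat.card k else 0) else 0 := by
    by_cases ha : a = 0
    · subst ha
      by_cases ht : t = 0
      · simp [ht, add_comm]
      · simp [ht, Ne.symm ht]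
    · have hb (b : k) : 2 * a * b = t ↔ b = t / (2 * a) := by
        rw [eq_div_iff (mul_ne_zero h2 ha), mul_comm]
      simp [ha, hb]
  have hs := Finset.sum_congr (rfl : (Finset.univ : Finset k) = _) fun a _ => h a
  rw [Finset.sum_add_distrib, Finset.sum_add_distrib] at hs
  rw [Nat.card_eq_fintype_card, Fintype.card_subtype, Finset.card_filter, Fintype.sum_prod_type]
  simpa using hs

theorem card_hyperbola_bundle (h2 : (2 : k) ≠ 0) {Y : Type*} [Finite Y] (f : Y → k) :
    Nat.card {p : (k × k) × Y // 2 * p.1.1 * p.1.2 = f p.2} + Nat.card Y =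
      Nat.card k * Nat.card Y + Nat.card k * Nat.card {y // f y = 0} := by
  classical
  have := Fintype.ofFinite k
  have := Fintype.ofFinite Y
  have hs := Finset.sum_congr (rfl : (Finset.univ : Finset Y) = _)
    fun y _ => card_hyperbola h2 (f y)
  rw [Finset.sum_add_distrib, Finset.sum_add_distrib] at hs
  have hl : Nat.card {p : (k × k) × Y // 2 * p.1.1 * p.1.2 = f p.2} =
      ∑ y, Nat.card {p : k × k // 2 * p.1 * p.2 = f y} := by
    simp only [Nat.card_eq_fintype_card, Fintype.card_subtype, Finset.card_filter]
    rw [Fintype.sum_prod_type_right]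
  have hr : Nat.card k * Nat.card {y // f y = 0} = ∑ y, if f y = 0 then Nat.card k else 0 := by
    rw [Nat.card_eq_fintype_card (α := {y // f y = 0}), Fintype.card_subtype, Finset.card_filter,
      Finset.mul_sum]
    simp
  rw [hl, hr]
  simpa [mul_comm] using hs

/-- The form `Q` has `q ^ 4` isotropic vectors over the field with `q` elements. -/
theorem card_isotropic (h2 : (2 : k) ≠ 0) :
    Nat.card {x : Fin 5 → k // Q x x = 0} = Nat.card k ^ 4 := by
  let e : (Fin 5 → k) ≃ (k × k) × (k × k) × k :=
    { toFun x := ((x 0, x 4), (x 1, x 3), x 2)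
      invFun p := ![p.1.1, p.2.1.1, p.2.2, p.2.1.2, p.1.2]
      left_inv x := by ext i; fin_cases i <;> rfl
      right_inv p := rfl }
  let e' : {y : (k × k) × k // -(2 * y.1.1 * y.1.2 + y.2 ^ 2) = 0} ≃
      {y : (k × k) × k // 2 * y.1.1 * y.1.2 = -y.2 ^ 2} :=
    Equiv.subtypeEquivRight fun y => by rw [neg_eq_zero, add_eq_zero_iff_eq_neg]
  have h1 : Nat.card {x : Fin 5 → k // Q x x = 0} =
      Nat.card {p : (k × k) × (k × k) × k //
        2 * p.1.1 * p.1.2 = -(2 * p.2.1.1 * p.2.1.2 + p.2.2 ^ 2)} :=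
    Nat.card_congr (e.subtypeEquiv fun x => by
      rw [Q_apply, eq_neg_iff_add_eq_zero]
      change _ ↔ 2 * x 0 * x 4 + (2 * x 1 * x 3 + x 2 ^ 2) = 0
      ring_nf)
  have hA := card_hyperbola_bundle h2
    fun y : (k × k) × k => -(2 * y.1.1 * y.1.2 + y.2 ^ 2)
  have hB := card_hyperbola_bundle h2 fun y : k => -y ^ 2
  rw [Nat.card_congr e'] at hA
  have h0 : Nat.card {y : k // -y ^ 2 = 0} = 1 := by simp
  rw [← h1] at hA
  simp only [Nat.card_prod, h0] at hA hB
  have hB' : Nat.card {y : (k × k) × k // 2 * y.1.1 * y.1.2 = -y.2 ^ 2} =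
      Nat.card k * Nat.card k := by lia
  rw [hB'] at hA
  linear_combination hA

/-- The number of isotropic vectors orthogonal to a normal form. -/
theorem card_isotropic_orthogonal_normalForm (h2 : (2 : k) ≠ 0) (t : k) :
    Nat.card {x : Fin 5 → k // Q x x = 0 ∧ Q (normalForm t) x = 0} + Nat.card k ^ 2 =
      Nat.card k ^ 3 + Nat.card k * Nat.card {y : k × k // 2 * t * y.2 ^ 2 - y.1 ^ 2 = 0} := by
  let e : {x : Fin 5 → k // Q x x = 0 ∧ Q (normalForm t) x = 0} ≃
      {p : (k × k) × k × k // 2 * p.1.1 * p.1.2 = 2 * t * p.2.2 ^ 2 - p.2.1 ^ 2} :=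
    { toFun x := ⟨((x.1 1, x.1 3), x.1 2, x.1 4), by
        obtain ⟨x, hx, hw⟩ := x
        simp only [Q_apply, normalForm, Matrix.cons_val] at hx hw ⊢
        linear_combination hx - 2 * x 4 * hw⟩
      invFun p := ⟨![-t * p.1.2.2, p.1.1.1, p.1.2.1, p.1.1.2, p.1.2.2], by
        obtain ⟨p, hp⟩ := p
        simp only [Q_apply, normalForm, Matrix.cons_val] at hp ⊢
        constructor
        · linear_combination hp
        · ring⟩
      left_inv x := by
        obtain ⟨x, hx, hw⟩ := x
        simp only [Q_apply, normalForm, Matrix.cons_val] at hw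
        ext i
        fin_cases i <;> simp
        linear_combination -hw
      right_inv p := rfl }
  rw [Nat.card_congr e]
  have := card_hyperbola_bundle h2 fun y : k × k => 2 * t * y.2 ^ 2 - y.1 ^ 2
  rw [Nat.card_prod] at this
  linear_combination this

theorem card_isotropic_orthogonal (h2 : (2 : k) ≠ 0) {w : Fin 5 → k} (hw : w ≠ 0) :
    Nat.card {x : Fin 5 → k // Q x x = 0 ∧ Q w x = 0} + Nat.card k ^ 2 =
      Nat.card k ^ 3 + Nat.card k * Nat.card {y : k × k // Q w w * y.2 ^ 2 - y.1 ^ 2 = 0} := by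
  obtain ⟨i, hi⟩ := Function.ne_iff.mp hw
  have ht : 2 * (Q w w / 2) = Q w w := by field_simp
  obtain ⟨g, hg⟩ := exists_mulVec_eq_normalForm (mul_inv_cancel₀ h2) (isUnit_iff_ne_zero.mpr hi) ht
  let e : (Fin 5 → k) ≃ (Fin 5 → k) :=
    { toFun x := g.1.1 *ᵥ x
      invFun x := (g⁻¹).1.1 *ᵥ x
      left_inv := inv_mulVec_mulVec g
      right_inv := mulVec_inv_mulVec g }
  have := card_isotropic_orthogonal_normalForm h2 (Q w w / 2)
  rw [ht, ← hg] at this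
  rw [← this]
  congr 1
  exact Nat.card_congr (e.subtypeEquiv fun x => by
    change _ ↔ Q (g.1.1 *ᵥ x) (g.1.1 *ᵥ x) = 0 ∧ Q (g.1.1 *ᵥ w) (g.1.1 *ᵥ x) = 0
    rw [Q_mulVec, Q_mulVec])

theorem card_isotropic_orthogonal_of_isotropic (h2 : (2 : k) ≠ 0) {w : Fin 5 → k} (hw : w ≠ 0)
    (hQ : Q w w = 0) :
    Nat.card {x : Fin 5 → k // Q x x = 0 ∧ Q w x = 0} = Nat.card k ^ 3 := by
  have h := card_isotropic_orthogonal h2 hw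
  let e : {y : k × k // Q w w * y.2 ^ 2 - y.1 ^ 2 = 0} ≃ k :=
    { toFun y := y.1.2
      invFun a := ⟨(0, a), by simp [hQ]⟩
      left_inv y := by
        obtain ⟨⟨a, b⟩, hy⟩ := y
        have : a = 0 := by simpa [hQ] using hy
        simp [this]
      right_inv a := rfl }
  rw [Nat.card_congr e] at h
  linear_combination h

theorem card_isotropic_orthogonal_of_isSquare (h2 : (2 : k) ≠ 0) {w : Fin 5 → k}
    (hQ : Q w w ≠ 0) (hs : IsSquare (Q w w)) :
    Nat.card {x : Fin 5 → k // Q x x = 0 ∧ Q w x = 0} + Nat.card k =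
      Nat.card k ^ 3 + Nat.card k ^ 2 := by
  classical
  have hw : w ≠ 0 := by
    rintro rfl
    simp [Q_apply] at hQ
  have h := card_isotropic_orthogonal h2 hw
  obtain ⟨s, hs⟩ := hs
  rw [hs] at h hQ
  have hs0 : s ≠ 0 := left_ne_zero_of_mul hQ
  let e : k × k ≃ k × k :=
    { toFun y := (s * y.2 - y.1, s * y.2 + y.1)
      invFun p := ((p.2 - p.1) / 2, (p.1 + p.2) / (2 * s))
      left_inv y := by ext <;> simp <;> field_simp <;> ring
      right_inv p := by ext <;> simp <;> field_simp <;> ring }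
  have he : Nat.card {y : k × k // s * s * y.2 ^ 2 - y.1 ^ 2 = 0} =
      Nat.card {p : k × k // 2 * p.1 * p.2 = 0} :=
    Nat.card_congr (e.subtypeEquiv fun y => by
      change _ ↔ 2 * (s * y.2 - y.1) * (s * y.2 + y.1) = 0
      rw [mul_assoc 2, mul_eq_zero, or_iff_right h2]
      ring_nf)
  have hc := card_hyperbola h2 (0 : k)
  rw [if_pos rfl, ← he] at hc
  linear_combination h + Nat.card k * hc

theorem card_isotropic_orthogonal_of_not_isSquare (h2 : (2 : k) ≠ 0) {w : Fin 5 → k}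
    (hs : ¬ IsSquare (Q w w)) :
    Nat.card {x : Fin 5 → k // Q x x = 0 ∧ Q w x = 0} + Nat.card k ^ 2 =
      Nat.card k ^ 3 + Nat.card k := by
  have hw : w ≠ 0 := by
    rintro rfl
    simp [Q_apply] at hs
  have h := card_isotropic_orthogonal h2 hw
  have hu (y : k × k) : Q w w * y.2 ^ 2 - y.1 ^ 2 = 0 ↔ y = 0 := by
    constructor
    · intro hy
      have h0 : y.2 = 0 := by
        by_contra h0
        refine hs ⟨y.1 / y.2, ?_⟩
        field_simp
        linear_combination hy
      have h1 : y.1 = 0 := by simpa [h0] using hy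
      exact Prod.ext h1 h0
    · rintro rfl
      simp
  simp only [hu, Nat.card_unique, mul_one] at h
  exact h

/-- The number of non-zero vectors of the line spanned by a non-zero vector. -/
theorem card_units_smul_eq {w : Fin 5 → k} (hw : w ≠ 0) :
    Nat.card {x : Fin 5 → k // ∃ a : kˣ, w = a • x} + 1 = Nat.card k := by
  have hsurj : Function.Bijective
      fun a : kˣ => (⟨a⁻¹ • w, a, by simp⟩ : {x : Fin 5 → k // ∃ a : kˣ, w = a • x}) := by
    constructor
    · intro a b hab
      obtain ⟨i, hi⟩ := Function.ne_iff.mp hw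
      have := congrFun (congrArg Subtype.val hab) i
      exact Units.ext (by simpa [Units.smul_def, show w i ≠ 0 from hi] using this)
    · rintro ⟨x, a, rfl⟩
      exact ⟨a, by simp⟩
  rw [← Nat.card_congr (Equiv.ofBijective _ hsurj), Nat.card_units,
    Nat.sub_add_cancel Nat.card_pos]

theorem card_ne_zero_and {ι : Type*} [Finite ι] [Zero ι] {P : ι → Prop} (h0 : P 0) :
    Nat.card {x : ι // x ≠ 0 ∧ P x} + 1 = Nat.card {x : ι // P x} := by
  have h : {x : ι | P x} = insert 0 {x : ι | x ≠ 0 ∧ P x} := by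
    ext x
    by_cases hx : x = 0 <;> simp [hx, h0]
  have := Set.ncard_insert_of_notMem (a := (0 : ι)) (s := {x : ι | x ≠ 0 ∧ P x}) (by simp)
  rw [← h] at this
  exact this.symm

end Count

section LocalRing

variable {A : Type*} [CommRing A] [IsLocalRing A]

/-- Reduction of vectors to the residue field. -/
noncomputable def red (w : Fin 5 → A) : Fin 5 → IsLocalRing.ResidueField A :=
  IsLocalRing.residue A ∘ w

theorem Q_red (v w : Fin 5 → A) : Q (red v) (red w) = IsLocalRing.residue A (Q v w) :=
  Q_map _ v w

theorem red_ne_zero_iff {w : Fin 5 → A} : red w ≠ 0 ↔ ∃ i, IsUnit (w i) := by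
  rw [Function.ne_iff]
  exact exists_congr fun i => IsLocalRing.residue_ne_zero_iff_isUnit (w i)

theorem red_mulVec (g : G A) (w : Fin 5 → A) :
    red (g.1.1 *ᵥ w) = (mapG (IsLocalRing.residue A) g).1.1 *ᵥ red w :=
  (mapG_mulVec _ g w).symm

theorem red_specialLinear_mulVec_ne_zero (s : Matrix.SpecialLinearGroup (Fin 5) A)
    {w : Fin 5 → A} (hw : red w ≠ 0) : red (s.1 *ᵥ w) ≠ 0 := by
  intro h
  refine hw ?_
  have hred (M : Matrix (Fin 5) (Fin 5) A) (v : Fin 5 → A) :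
      red (M *ᵥ v) = M.map (IsLocalRing.residue A) *ᵥ red v :=
    funext fun i => RingHom.map_mulVec (IsLocalRing.residue A) M v i
  have h1 : (s⁻¹).1 *ᵥ (s.1 *ᵥ w) = w := by
    rw [Matrix.mulVec_mulVec, ← Matrix.SpecialLinearGroup.coe_mul, inv_mul_cancel,
      Matrix.SpecialLinearGroup.coe_one, Matrix.one_mulVec]
  rw [← h1, hred, h, Matrix.mulVec_zero]

theorem exists_red_eq (x : Fin 5 → IsLocalRing.ResidueField A) : ∃ w : Fin 5 → A, red w = x :=
  ⟨fun i => (IsLocalRing.residue_surjective (x i)).choose,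
    funext fun i => (IsLocalRing.residue_surjective (x i)).choose_spec⟩

/-- Every non-zero isotropic vector of the reduction is moved to the last basis vector by an element
of `SO(J)` over the local ring. -/
theorem exists_red_mulVec_eq {h : A} (h2 : 2 * h = 1) {x : Fin 5 → IsLocalRing.ResidueField A}
    (hx : x ≠ 0) (hQ : Q x x = 0) :
    ∃ g : G A, (mapG (IsLocalRing.residue A) g).1.1 *ᵥ x = normalForm 0 := by
  obtain ⟨w, rfl⟩ := exists_red_eq x
  obtain ⟨i, hi⟩ := red_ne_zero_iff.mp hx
  obtain ⟨g, hg⟩ := exists_mulVec_eq_normalForm h2 hi (t := h * Q w w)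
    (by linear_combination Q w w * h2)
  refine ⟨g, ?_⟩
  rw [← red_mulVec, hg]
  have h0 : IsLocalRing.residue A (h * Q w w) = 0 := by rw [map_mul, ← Q_red, hQ, mul_zero]
  ext i
  fin_cases i <;> simp [red, normalForm, h0]

/-- The condition that `ϖ⁻¹ w` lies in the lattice adjacent to the standard lattice along the
isotropic line spanned by `x`, for `w` with `Q w w` divisible by `ϖ²`. -/
def Adjacent (ϖ : A) (w : Fin 5 → A) (x : Fin 5 → IsLocalRing.ResidueField A) : Prop :=
  (∃ w', w = ϖ • w' ∧ Q (red w') x = 0) ∨ ∃ a : (IsLocalRing.ResidueField A)ˣ, red w = a • x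

theorem adjacent_mulVec_iff (g : G A) (ϖ : A) (w : Fin 5 → A)
    (x : Fin 5 → IsLocalRing.ResidueField A) :
    Adjacent ϖ (g.1.1 *ᵥ w) ((mapG (IsLocalRing.residue A) g).1.1 *ᵥ x) ↔ Adjacent ϖ w x := by
  refine or_congr ⟨?_, ?_⟩ (exists_congr fun a => ?_)
  · rintro ⟨w', hw, hx⟩
    refine ⟨(g⁻¹).1.1 *ᵥ w', ?_, ?_⟩
    · rw [← Matrix.mulVec_smul, ← hw, inv_mulVec_mulVec]
    · rw [← hx, ← Q_mulVec (mapG (IsLocalRing.residue A) g), ← red_mulVec, mulVec_inv_mulVec]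
  · rintro ⟨w', rfl, hx⟩
    exact ⟨g.1.1 *ᵥ w', Matrix.mulVec_smul _ _ _, by rw [red_mulVec, Q_mulVec, hx]⟩
  · rw [red_mulVec, ← Matrix.mulVec_smul]
    exact (mulVec_injective _).eq_iff

theorem exists_eq_smul_iff {ϖ : A} (hϖ : ∀ a : A, ϖ ∣ a ↔ ¬ IsUnit a)
    {w : Fin 5 → A} : (∃ w', w = ϖ • w') ↔ red w = 0 := by
  constructor
  · rintro ⟨w', rfl⟩
    by_contra h
    obtain ⟨i, hi⟩ := red_ne_zero_iff.mp h
    exact (hϖ _).mp (dvd_mul_right ϖ (w' i)) hi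
  · intro h
    have h' (i : Fin 5) : ϖ ∣ w i := by
      rw [hϖ]
      exact fun hi => red_ne_zero_iff.mpr ⟨i, hi⟩ h
    choose w' hw' using h'
    exact ⟨w', funext hw'⟩

theorem adjacent_normalForm_iff {ϖ : A} (hϖ : ∀ a : A, ϖ ∣ a ↔ ¬ IsUnit a)
    {h : A} (h2 : 2 * h = 1)
    {u : Fin 5 → A} (hu : ϖ ^ 2 ∣ Q u u) :
    Adjacent ϖ u (normalForm 0) ↔ ϖ ^ 2 ∣ u 0 ∧ ϖ ∣ u 1 ∧ ϖ ∣ u 2 ∧ ϖ ∣ u 3 := by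
  have hres (a : A) : IsLocalRing.residue A a = 0 ↔ ϖ ∣ a := by
    rw [IsLocalRing.residue_eq_zero_iff, IsLocalRing.mem_maximalIdeal, mem_nonunits_iff, hϖ]
  constructor
  · rintro (⟨w', rfl, hx⟩ | ⟨a, ha⟩)
    · have h3 : ϖ ∣ w' 0 := by
        rw [← hres]
        simpa [Q_apply, normalForm, red] using hx
      refine ⟨?_, dvd_mul_right _ _, dvd_mul_right _ _, dvd_mul_right _ _⟩
      rw [pow_two]
      exact mul_dvd_mul_left ϖ h3
    · have h3 (i : Fin 5) : IsLocalRing.residue A (u i) = a * normalForm 0 i := by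
        simpa [red, Units.smul_def] using congrFun ha i
      obtain ⟨y, hy⟩ := (hres _).mp (by simpa [normalForm] using h3 1)
      obtain ⟨z, hz⟩ := (hres _).mp (by simpa [normalForm] using h3 2)
      obtain ⟨s, hs⟩ := (hres _).mp (by simpa [normalForm] using h3 3)
      have h4 : IsUnit (u 4) := by
        rw [← IsLocalRing.residue_ne_zero_iff_isUnit, h3 4]
        simp [normalForm]
      refine ⟨?_, ⟨y, hy⟩, ⟨z, hz⟩, ⟨s, hs⟩⟩
      obtain ⟨c, hc⟩ := hu
      obtain ⟨b, hb⟩ := h4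
      refine ⟨h * ((b⁻¹ : Aˣ) : A) * (c - 2 * y * s - z ^ 2), ?_⟩
      have hbb : ((b⁻¹ : Aˣ) : A) * u 4 = 1 := by rw [← hb]; simp
      simp only [Q_apply, hy, hz, hs] at hc
      linear_combination (-u 0 * (2 * h)) * hbb - u 0 * h2 + h * ((b⁻¹ : Aˣ) : A) * hc
  · rintro ⟨⟨x, hx⟩, hy, hz, hs⟩
    by_cases h4 : IsUnit (u 4)
    · refine Or.inr ⟨Units.mk0 _ ((IsLocalRing.residue_ne_zero_iff_isUnit (u 4)).mpr h4), ?_⟩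
      have hx' := (hres _).mpr ((dvd_pow_self ϖ two_ne_zero).trans ⟨x, hx⟩)
      rw [← hres] at hy hz hs
      ext i
      fin_cases i <;> simp [red, normalForm, Units.smul_def, hx', hy, hz, hs]
    · rw [← hϖ] at h4
      obtain ⟨y, hy⟩ := hy
      obtain ⟨z, hz⟩ := hz
      obtain ⟨s, hs⟩ := hs
      obtain ⟨t, ht⟩ := h4
      refine Or.inl ⟨![ϖ * x, y, z, s, t], ?_, ?_⟩
      · ext i
        fin_cases i <;> simp [hx, hy, hz, hs, ht, pow_two, mul_assoc]
      · simp [Q_apply, normalForm, red, (hres ϖ).mpr dvd_rfl]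

/-- The non-zero isotropic vectors of the residue field. -/
abbrev Isotropic (k : Type*) [Field k] := {x : Fin 5 → k // x ≠ 0 ∧ Q x x = 0}

theorem card_adjacent_smul [IsDomain A] [Finite (IsLocalRing.ResidueField A)]
    {ϖ : A} (hϖ : ∀ a : A, ϖ ∣ a ↔ ¬ IsUnit a) (h0 : ϖ ≠ 0) (w : Fin 5 → A) :
    Nat.card {x : Isotropic (IsLocalRing.ResidueField A) // Adjacent ϖ (ϖ • w) x.1} + 1 =
      Nat.card {x : Fin 5 → IsLocalRing.ResidueField A // Q x x = 0 ∧ Q (red w) x = 0} := by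
  rw [← card_ne_zero_and (P := fun x : Fin 5 → IsLocalRing.ResidueField A =>
    Q x x = 0 ∧ Q (red w) x = 0) (by simp [Q_apply])]
  congr 1
  refine Nat.card_congr ((Equiv.subtypeEquivRight fun x => ?_).trans
    ((Equiv.subtypeSubtypeEquivSubtypeInter _ fun x => Q (red w) x = 0).trans
      (Equiv.subtypeEquivRight fun x => and_assoc)))
  obtain ⟨x, hx, -⟩ := x
  constructor
  · rintro (⟨w', hw, hQ⟩ | ⟨a, ha⟩)
    · have : w = w' := funext fun i => mul_left_cancel₀ h0 (congrFun hw i)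
      rwa [this]
    · rw [(exists_eq_smul_iff hϖ).mp ⟨w, rfl⟩] at ha
      exact absurd ((smul_eq_zero_iff_eq a).mp ha.symm) hx
  · exact fun hQ => Or.inl ⟨w, rfl, hQ⟩

theorem card_adjacent_of_primitive [Finite (IsLocalRing.ResidueField A)]
    {ϖ : A} (hϖ : ∀ a : A, ϖ ∣ a ↔ ¬ IsUnit a) {w : Fin 5 → A} (hw : red w ≠ 0)
    (hQ : Q (red w) (red w) = 0) :
    Nat.card {x : Isotropic (IsLocalRing.ResidueField A) // Adjacent ϖ w x.1} + 1 =
      Nat.card (IsLocalRing.ResidueField A) := by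
  rw [← card_units_smul_eq hw]
  congr 1
  refine Nat.card_congr ((Equiv.subtypeEquivRight fun x => ?_).trans
    (Equiv.subtypeSubtypeEquivSubtype
      (q := fun x => ∃ a : (IsLocalRing.ResidueField A)ˣ, red w = a • x) ?_))
  · refine ⟨?_, Or.inr⟩
    rintro (⟨w', hw', -⟩ | h)
    · exact absurd ((exists_eq_smul_iff hϖ).mp ⟨w', hw'⟩) hw
    · exact h
  · rintro x ⟨a, ha⟩
    rw [ha] at hw hQ
    refine ⟨fun h => hw (by rw [h, smul_zero]), ?_⟩
    simpa [Units.smul_def, Q_smul_smul] using hQ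

end LocalRing

section Field

variable {F : Type*} [Field F] [ValuativeRel F]

/-- The inclusion of the standard lattice. -/
noncomputable def emb (w : Fin 5 → 𝒪[F]) : Fin 5 → F := 𝒪[F].subtype ∘ w

theorem emb_injective : Function.Injective (emb (F := F)) := fun _ _ h =>
  funext fun i => Subtype.ext (congrFun h i)

theorem emb_smul (a : 𝒪[F]) (w : Fin 5 → 𝒪[F]) : emb (a • w) = (a : F) • emb w := by
  ext i
  simp [emb]

theorem emb_mulVec (g : G 𝒪[F]) (w : Fin 5 → 𝒪[F]) :
    emb (g.1.1 *ᵥ w) = (mapG 𝒪[F].subtype g).1.1 *ᵥ emb w :=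
  (mapG_mulVec _ g w).symm

theorem Q_emb (v w : Fin 5 → 𝒪[F]) : Q (emb v) (emb w) = (Q v w : 𝒪[F]) :=
  Q_map _ v w

/-- The vectors of a quadric that become integral after multiplication by `a`. -/
def ball (c a : F) : Set (sphere c) := {v | ∃ w : Fin 5 → 𝒪[F], emb w = a • v.1}

/-- The vectors of a quadric that become primitive integral vectors after multiplication by `a`. -/
def shell (c a : F) : Set (sphere c) :=
  {v | ∃ w : Fin 5 → 𝒪[F], emb w = a • v.1 ∧ red w ≠ 0}

theorem mapG_subtype_mem_K (g : G 𝒪[F]) : mapG 𝒪[F].subtype g ∈ K F := ⟨g.1, rfl⟩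

theorem Q_eq_of_emb_eq {c a : F} {v : sphere c} {w : Fin 5 → 𝒪[F]} (h : emb w = a • v.1) :
    ((Q w w : 𝒪[F]) : F) = a ^ 2 * c := by
  rw [← Q_emb, h, Q_smul_smul, show Q v.1 v.1 = c from v.2, pow_two]

/-- The orbits of the maximal compact subgroup are the shells. -/
theorem orbit_eq_shell {h : 𝒪[F]} (h2 : 2 * h = 1) {c a : F} (ha : a ≠ 0) {v : sphere c}
    (hv : v ∈ shell c a) : MulAction.orbit (K F) v = shell c a := by
  obtain ⟨w, hw, hw0⟩ := hv
  ext v'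
  constructor
  · rintro ⟨⟨k, s, hs⟩, rfl⟩
    refine ⟨s.1 *ᵥ w, ?_, red_specialLinear_mulVec_ne_zero s hw0⟩
    change _ = a • (k.1.1 *ᵥ v.1)
    have hs' : k.1.1 = s.1.map 𝒪[F].subtype := (congrArg Subtype.val hs).symm
    rw [← Matrix.mulVec_smul, ← hw, hs']
    exact funext fun i => RingHom.map_mulVec 𝒪[F].subtype s.1 w i
  · rintro ⟨w', hw', hw0'⟩
    have hQ : Q w w = Q w' w' :=
      Subtype.ext ((Q_eq_of_emb_eq hw).trans (Q_eq_of_emb_eq hw').symm)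
    obtain ⟨i, hi⟩ := red_ne_zero_iff.mp hw0
    obtain ⟨i', hi'⟩ := red_ne_zero_iff.mp hw0'
    have ht : 2 * (h * Q w w) = Q w w := by linear_combination Q w w * h2
    obtain ⟨g, hg⟩ := exists_mulVec_eq_normalForm h2 hi ht
    obtain ⟨g', hg'⟩ := exists_mulVec_eq_normalForm h2 hi' (ht.trans hQ)
    refine ⟨⟨_, mapG_subtype_mem_K (g'⁻¹ * g)⟩, Subtype.ext ?_⟩
    change (mapG 𝒪[F].subtype (g'⁻¹ * g)).1.1 *ᵥ v.1 = v'.1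
    refine smul_right_injective _ ha ?_
    change a • _ = a • _
    rw [← Matrix.mulVec_smul, ← hw, ← hw', ← emb_mulVec, mul_mulVec, hg, ← hg', inv_mulVec_mulVec]

/-- The vectors `v` of a quadric for which `ϖ ^ r • v` lies in the lattice adjacent to the standard
lattice along the line spanned by `x`. -/
def adjacentBall (ϖ : 𝒪[F]) (c : F) (r : ℕ) (x : Fin 5 → 𝓀[F]) : Set (sphere c) :=
  {v | ∃ w : Fin 5 → 𝒪[F], emb w = (ϖ : F) ^ (r + 1) • v.1 ∧ Adjacent ϖ w x}

/-- An adjacent lattice is a translate of the standard lattice. -/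
theorem exists_adjacentBall_eq_preimage {ϖ : 𝒪[F]} (h0 : ϖ ≠ 0)
    (hϖ : ∀ a : 𝒪[F], ϖ ∣ a ↔ ¬ IsUnit a) {h : 𝒪[F]} (h2 : 2 * h = 1) (c : 𝒪[F]) (r : ℕ)
    {x : Fin 5 → 𝓀[F]} (hx : x ≠ 0) (hQ : Q x x = 0) :
    ∃ g : G F, adjacentBall ϖ (c : F) r x = (fun v => g • v) ⁻¹' ball (c : F) ((ϖ : F) ^ r) := by
  have h0' : (ϖ : F) ≠ 0 := fun h => h0 (Subtype.ext h)
  obtain ⟨g, hg⟩ := exists_red_mulVec_eq h2 hx hQ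
  let p : Fˣ := Units.mk0 (ϖ : F) h0'
  refine ⟨diagElt p⁻¹ * mapG 𝒪[F].subtype g, ?_⟩
  ext v
  change _ ↔ ∃ y, emb y = (ϖ : F) ^ r •
    ((diagElt p⁻¹ * mapG 𝒪[F].subtype g).1.1 *ᵥ v.1)
  have hcoord (y : Fin 5 → 𝒪[F]) :
      emb y = (ϖ : F) ^ r • ((diagElt p⁻¹ * mapG 𝒪[F].subtype g).1.1 *ᵥ v.1) ↔
        emb ![ϖ ^ 2 * y 0, ϖ * y 1, ϖ * y 2, ϖ * y 3, y 4] =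
          (ϖ : F) ^ (r + 1) • ((mapG 𝒪[F].subtype g).1.1 *ᵥ v.1) := by
    rw [mul_mulVec, diagElt_mulVec]
    generalize (mapG 𝒪[F].subtype g).1.1 *ᵥ v.1 = z
    have hscale {s : F} (hs : s ≠ 0) {a b b' : F} (hb : b' = s * b) : a = b ↔ s * a = b' := by
      rw [hb, mul_right_inj' hs]
    simp only [funext_iff, Fin.forall_fin_succ, emb, Function.comp_apply, Pi.smul_apply,
      smul_eq_mul, Subring.subtype_apply]
    refine and_congr ?_ (and_congr ?_ (and_congr ?_ (and_congr ?_ (and_congr ?_ ?_))))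
    · simpa [p] using hscale (pow_ne_zero 2 h0') (by field_simp; ring)
    · simpa [p] using hscale h0' (by ring)
    · simpa [p] using hscale h0' (by ring)
    · simpa [p] using hscale h0' (by ring)
    · simp [p, pow_succ, mul_assoc]
    · simp
  constructor
  · rintro ⟨w, hw, hadj⟩
    have hu : ϖ ^ 2 ∣ Q (g.1.1 *ᵥ w) (g.1.1 *ᵥ w) := by
      refine ⟨(ϖ ^ r) ^ 2 * c, ?_⟩
      rw [Q_mulVec]
      refine Subtype.ext ((Q_eq_of_emb_eq hw).trans ?_)
      push_cast
      ring
    rw [← adjacent_mulVec_iff g, hg, adjacent_normalForm_iff hϖ h2 hu] at hadj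
    obtain ⟨⟨a₀, e0⟩, ⟨a₁, e1⟩, ⟨a₂, e2⟩, ⟨a₃, e3⟩⟩ := hadj
    refine ⟨![a₀, a₁, a₂, a₃, (g.1.1 *ᵥ w) 4], (hcoord _).mpr ?_⟩
    rw [← Matrix.mulVec_smul, ← hw, ← emb_mulVec]
    congr 1
    ext i
    fin_cases i <;> simp [e0, e1, e2, e3]
  · rintro ⟨y, hy⟩
    rw [hcoord] at hy
    set u : Fin 5 → 𝒪[F] := ![ϖ ^ 2 * y 0, ϖ * y 1, ϖ * y 2, ϖ * y 3, y 4] with hu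
    have hw : emb ((g⁻¹).1.1 *ᵥ u) = (ϖ : F) ^ (r + 1) • v.1 := by
      refine mulVec_injective (mapG 𝒪[F].subtype g) ?_
      change (mapG 𝒪[F].subtype g).1.1 *ᵥ _ = (mapG 𝒪[F].subtype g).1.1 *ᵥ _
      rw [← emb_mulVec, mulVec_inv_mulVec, hy, Matrix.mulVec_smul]
    refine ⟨_, hw, ?_⟩
    rw [← adjacent_mulVec_iff g, hg, mulVec_inv_mulVec, adjacent_normalForm_iff hϖ h2]
    · simp [hu]
    · refine ⟨(ϖ ^ r) ^ 2 * c, ?_⟩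
      rw [← Q_mulVec g⁻¹]
      refine Subtype.ext ((Q_eq_of_emb_eq hw).trans ?_)
      push_cast
      ring

theorem disjoint_ball_shell {ϖ : 𝒪[F]} (hϖ : ∀ a : 𝒪[F], ϖ ∣ a ↔ ¬ IsUnit a)
    (c a : F) : Disjoint (ball c a) (shell c ((ϖ : F) * a)) := by
  refine Set.disjoint_left.mpr ?_
  rintro v ⟨w, hw⟩ ⟨w', hw', hp⟩
  refine hp ((exists_eq_smul_iff hϖ).mp ⟨w, emb_injective ?_⟩)
  rw [hw', emb_smul, hw, smul_smul]

theorem ball_union_shell {ϖ : 𝒪[F]} (h0 : ϖ ≠ 0) (hϖ : ∀ a : 𝒪[F], ϖ ∣ a ↔ ¬ IsUnit a)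
    (c a : F) : ball c a ∪ shell c ((ϖ : F) * a) = ball c ((ϖ : F) * a) := by
  have h0' : (ϖ : F) ≠ 0 := fun h => h0 (Subtype.ext h)
  ext v
  constructor
  · rintro (⟨w, hw⟩ | ⟨w, hw, -⟩)
    · exact ⟨ϖ • w, by rw [emb_smul, hw, smul_smul]⟩
    · exact ⟨w, hw⟩
  · rintro ⟨w, hw⟩
    by_cases hp : red w = 0
    · obtain ⟨w', rfl⟩ := (exists_eq_smul_iff hϖ).mpr hp
      refine Or.inl ⟨w', smul_right_injective _ h0' ?_⟩
      change (ϖ : F) • _ = (ϖ : F) • _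
      rw [← emb_smul, hw, smul_smul]
    · exact Or.inr ⟨w, hw, hp⟩

/-- The number of adjacent lattices that contain a given vector. -/
theorem card_mem_adjacentBall [Finite 𝓀[F]] {ϖ : 𝒪[F]} (h0 : ϖ ≠ 0)
    (hϖ : ∀ a : 𝒪[F], ϖ ∣ a ↔ ¬ IsUnit a) (h2 : (2 : 𝓀[F]) ≠ 0) (c : 𝒪[F]) (r N : ℕ)
    (hN : ∀ w : Fin 5 → 𝒪[F], red w ≠ 0 → Q w w = (ϖ ^ r) ^ 2 * c →
      Nat.card {x : Fin 5 → 𝓀[F] // Q x x = 0 ∧ Q (red w) x = 0} = N + 1)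
    (v : sphere (c : F)) :
    Nat.card {x : Isotropic 𝓀[F] // v ∈ adjacentBall ϖ (c : F) r x.1} =
      (ball (c : F) ((ϖ : F) ^ r / ϖ)).indicator (fun _ => Nat.card 𝓀[F] ^ 4 - 1) v +
      (shell (c : F) ((ϖ : F) ^ r)).indicator (fun _ => N) v +
      (shell (c : F) ((ϖ : F) ^ (r + 1))).indicator (fun _ => Nat.card 𝓀[F] - 1) v := by
  have h0' : (ϖ : F) ≠ 0 := fun h => h0 (Subtype.ext h)
  have e1 : (ϖ : F) * ((ϖ : F) ^ r / ϖ) = (ϖ : F) ^ r := by field_simp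
  have hd1 := disjoint_ball_shell hϖ (c : F) ((ϖ : F) ^ r / ϖ)
  have hd2 := disjoint_ball_shell hϖ (c : F) ((ϖ : F) ^ r)
  have hu1 := ball_union_shell h0 hϖ (c : F) ((ϖ : F) ^ r / ϖ)
  have hu2 := ball_union_shell h0 hϖ (c : F) ((ϖ : F) ^ r)
  rw [e1] at hd1 hu1
  rw [← pow_succ'] at hd2 hu2
  have hmem {w : Fin 5 → 𝒪[F]} (hw : emb w = (ϖ : F) ^ (r + 1) • v.1) (x : Isotropic 𝓀[F]) :
      v ∈ adjacentBall ϖ (c : F) r x.1 ↔ Adjacent ϖ w x.1 := by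
    refine ⟨?_, fun h => ⟨w, hw, h⟩⟩
    rintro ⟨w', hw', h⟩
    rwa [emb_injective (hw.trans hw'.symm)]
  by_cases hv : v ∈ ball (c : F) ((ϖ : F) ^ r)
  · have hv2 : v ∉ shell (c : F) ((ϖ : F) ^ (r + 1)) := Set.disjoint_left.mp hd2 hv
    rw [Set.indicator_of_notMem hv2, add_zero]
    have hsmul {w : Fin 5 → 𝒪[F]} (hw : emb w = (ϖ : F) ^ r • v.1) :
        emb (ϖ • w) = (ϖ : F) ^ (r + 1) • v.1 := by rw [emb_smul, hw, smul_smul, pow_succ']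
    rw [← hu1] at hv
    obtain hv | hv := hv
    · rw [Set.indicator_of_mem hv, Set.indicator_of_notMem (Set.disjoint_left.mp hd1 hv), add_zero]
      obtain ⟨w, hw⟩ := hv
      have hw' : emb (ϖ • w) = (ϖ : F) ^ r • v.1 := by rw [emb_smul, hw, smul_smul, e1]
      simp only [hmem (hsmul hw')]
      have hc := card_adjacent_smul hϖ h0 (ϖ • w)
      rw [(exists_eq_smul_iff hϖ).mp ⟨w, rfl⟩] at hc
      have hQ (x : Fin 5 → 𝓀[F]) : Q 0 x = 0 := by simp [Q_apply]
      simp only [hQ, and_true, card_isotropic h2] at hc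
      lia
    · rw [Set.indicator_of_mem hv, Set.indicator_of_notMem (Set.disjoint_right.mp hd1 hv), zero_add]
      obtain ⟨w, hw, hp⟩ := hv
      simp only [hmem (hsmul hw)]
      have hc := card_adjacent_smul hϖ h0 w
      rw [hN w hp (Subtype.ext (by rw [Q_eq_of_emb_eq hw]; push_cast; rfl))] at hc
      lia
  · have hv' := hv
    rw [← hu1, Set.mem_union, not_or] at hv'
    rw [Set.indicator_of_notMem hv'.1, Set.indicator_of_notMem hv'.2, zero_add, zero_add]
    by_cases hs : v ∈ shell (c : F) ((ϖ : F) ^ (r + 1))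
    · rw [Set.indicator_of_mem hs]
      obtain ⟨w, hw, hp⟩ := hs
      simp only [hmem hw]
      have hQ : Q (red w) (red w) = 0 := by
        rw [Q_red, IsLocalRing.residue_eq_zero_iff, IsLocalRing.mem_maximalIdeal,
          mem_nonunits_iff, ← hϖ]
        refine ⟨ϖ * (ϖ ^ r) ^ 2 * c, Subtype.ext ((Q_eq_of_emb_eq hw).trans ?_)⟩
        push_cast
        ring
      have hc := card_adjacent_of_primitive hϖ hp hQ
      lia
    · rw [Set.indicator_of_notMem hs]
      have : IsEmpty {x : Isotropic 𝓀[F] // v ∈ adjacentBall ϖ (c : F) r x.1} := by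
        constructor
        rintro ⟨x, w, hw, -⟩
        have : v ∈ ball (c : F) ((ϖ : F) ^ (r + 1)) := ⟨w, hw⟩
        rw [← hu2] at this
        exact this.elim hv hs
      exact Nat.card_of_isEmpty

end Field

section LocalField

variable {F : Type*} [Field F] [ValuativeRel F]

theorem shell_subset_ball (c a : F) : shell c a ⊆ ball c a := fun _ ⟨w, hw, _⟩ => ⟨w, hw⟩

theorem ball_eq_preimage {a : F} (ha : a ≠ 0) (c : F) :
    ball c a = Subtype.val ⁻¹' Set.range fun w : Fin 5 → 𝒪[F] => a⁻¹ • emb w := by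
  ext v
  exact exists_congr fun w => (inv_smul_eq_iff₀ ha).symm

variable [TopologicalSpace F]

theorem continuous_emb : Continuous (emb (F := F)) :=
  continuous_pi fun i => continuous_subtype_val.comp (continuous_apply i)

variable [IsNonarchimedeanLocalField F]

theorem t2Space_of_isNonarchimedeanLocalField : T2Space F := by
  let := IsTopologicalAddGroup.rightUniformSpace F
  have := isUniformAddGroup_of_addCommGroup (G := F)
  infer_instance

theorem isSquare_of_isSquare_residue (h2 : (2 : 𝓀[F]) ≠ 0) {a : 𝒪[F]}
    (h0 : IsLocalRing.residue 𝒪[F] a ≠ 0) (ha : IsSquare (IsLocalRing.residue 𝒪[F] a)) :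
    IsSquare a := by
  let := IsTopologicalAddGroup.rightUniformSpace F
  have := isUniformAddGroup_of_addCommGroup (G := F)
  have hens : HenselianRing 𝒪[F] 𝓂[F] := inferInstance
  obtain ⟨s, hs⟩ := ha
  obtain ⟨b, rfl⟩ := IsLocalRing.residue_surjective s
  have hb : IsLocalRing.residue 𝒪[F] b ≠ 0 := by
    intro hb
    rw [hb, mul_zero] at hs
    exact h0 hs
  obtain ⟨y, hy, -⟩ := hens.is_henselian (Polynomial.X ^ 2 - Polynomial.C a)
    (Polynomial.monic_X_pow_sub_C a two_ne_zero) b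
    (by
      rw [← IsLocalRing.residue_eq_zero_iff]
      simp [hs, pow_two])
    (by
      change IsUnit (IsLocalRing.residue 𝒪[F] _)
      have : IsLocalRing.residue 𝒪[F] (2 * b) ≠ 0 := by
        rw [map_mul, map_ofNat]
        exact mul_ne_zero h2 hb
      rw [isUnit_iff_ne_zero]
      convert this
      simp [one_add_one_eq_two])
  refine ⟨y, ?_⟩
  have : y ^ 2 - a = 0 := by simpa using hy
  linear_combination -this

theorem isClosed_sphere (c : F) : IsClosed (sphere c) := by
  have := t2Space_of_isNonarchimedeanLocalField (F := F)
  refine isClosed_eq ?_ continuous_const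
  simp only [Q_apply]
  fun_prop

theorem isCompact_range_smul_emb (a : F) :
    IsCompact (Set.range fun w : Fin 5 → 𝒪[F] => a • emb w) :=
  isCompact_range (continuous_emb.const_smul a)

theorem isCompact_ball {a : F} (ha : a ≠ 0) (c : F) : IsCompact (ball c a) := by
  rw [ball_eq_preimage ha]
  exact (isClosed_sphere c).isClosedEmbedding_subtypeVal.isCompact_preimage
    (isCompact_range_smul_emb _)

theorem measurableSet_ball {a : F} (ha : a ≠ 0) (c : F) : MeasurableSet (ball c a) := by
  have := t2Space_of_isNonarchimedeanLocalField (F := F)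
  exact (isCompact_ball ha c).measurableSet

theorem measurable_smul_sphere {c : F} (g : G F) : Measurable fun v : sphere c => g • v := by
  refine Continuous.measurable (Continuous.subtype_mk ?_ _)
  exact continuous_const.matrix_mulVec continuous_subtype_val

theorem measure_shell_ne_top {a : F} (ha : a ≠ 0) (c : F) (μ : Measure (sphere c))
    [IsFiniteMeasureOnCompacts μ] : μ (shell c a) ≠ ⊤ :=
  measure_ne_top_of_subset (shell_subset_ball c a) (isCompact_ball ha c).measure_ne_top

variable {ϖ : 𝒪[F]} {c : 𝒪[F]} (μ : Measure (sphere (c : F))) [IsFiniteMeasureOnCompacts μ]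
  [SMulInvariantMeasure (G F) (sphere (c : F)) μ]

/-- Comparison of the volumes of two consecutive shells. -/
theorem measure_shell_succ (h0 : ϖ ≠ 0) (hϖ : ∀ a : 𝒪[F], ϖ ∣ a ↔ ¬ IsUnit a)
    (h2 : (2 : 𝓀[F]) ≠ 0) (r N : ℕ)
    (hN : ∀ w : Fin 5 → 𝒪[F], red w ≠ 0 → Q w w = (ϖ ^ r) ^ 2 * c →
      Nat.card {x : Fin 5 → 𝓀[F] // Q x x = 0 ∧ Q (red w) x = 0} = N + 1) :
    ((Nat.card 𝓀[F] : ℝ) - 1) * μ.real (shell (c : F) ((ϖ : F) ^ (r + 1))) =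
      ((Nat.card 𝓀[F] : ℝ) ^ 4 - (N + 1)) * μ.real (shell (c : F) ((ϖ : F) ^ r)) := by
  classical
  have h0' : (ϖ : F) ≠ 0 := fun h => h0 (Subtype.ext h)
  have hunit : IsUnit (2 : 𝒪[F]) := by
    rw [← IsLocalRing.residue_ne_zero_iff_isUnit, map_ofNat]
    exact h2
  obtain ⟨h, hh⟩ := isUnit_iff_exists_inv.mp hunit
  have := Fintype.ofFinite (Isotropic 𝓀[F])
  have e1 : (ϖ : F) * ((ϖ : F) ^ r / ϖ) = (ϖ : F) ^ r := by field_simp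
  set P := ball (c : F) ((ϖ : F) ^ r / ϖ)
  set B := ball (c : F) ((ϖ : F) ^ r)
  set B' := ball (c : F) ((ϖ : F) ^ (r + 1))
  set S := shell (c : F) ((ϖ : F) ^ r)
  set S' := shell (c : F) ((ϖ : F) ^ (r + 1))
  have hd1 : Disjoint P S := by
    have := disjoint_ball_shell hϖ (c : F) ((ϖ : F) ^ r / ϖ)
    rwa [e1] at this
  have hd2 : Disjoint B S' := by
    have := disjoint_ball_shell hϖ (c : F) ((ϖ : F) ^ r)
    rwa [← pow_succ'] at this
  have hu1 : P ∪ S = B := by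
    have := ball_union_shell h0 hϖ (c : F) ((ϖ : F) ^ r / ϖ)
    rwa [e1] at this
  have hu2 : B ∪ S' = B' := by
    have := ball_union_shell h0 hϖ (c : F) ((ϖ : F) ^ r)
    rwa [← pow_succ'] at this
  have hP : MeasurableSet P := measurableSet_ball (by positivity) _
  have hB : MeasurableSet B := measurableSet_ball (by positivity) _
  have hB' : MeasurableSet B' := measurableSet_ball (by positivity) _
  have hS : MeasurableSet S := by
    rw [← hd1.sup_sdiff_cancel_left]
    exact (hu1 ▸ hB).diff hP
  have hS' : MeasurableSet S' := by
    rw [← hd2.sup_sdiff_cancel_left]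
    exact (hu2 ▸ hB').diff hB
  have hfB : μ B ≠ ⊤ := (isCompact_ball (by positivity) _).measure_ne_top
  have hfB' : μ B' ≠ ⊤ := (isCompact_ball (by positivity) _).measure_ne_top
  have hfP : μ P ≠ ⊤ := measure_ne_top_of_subset (hu1 ▸ Set.subset_union_left) hfB
  have hfS : μ S ≠ ⊤ := measure_ne_top_of_subset (hu1 ▸ Set.subset_union_right) hfB
  have hfS' : μ S' ≠ ⊤ := measure_ne_top_of_subset (hu2 ▸ Set.subset_union_right) hfB'
  have hadj (x : Isotropic 𝓀[F]) : MeasurableSet (adjacentBall ϖ (c : F) r x.1) ∧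
      μ (adjacentBall ϖ (c : F) r x.1) = μ B := by
    obtain ⟨g, hg⟩ := exists_adjacentBall_eq_preimage h0 hϖ hh c r x.2.1 x.2.2
    rw [hg]
    exact ⟨measurable_smul_sphere g hB, SMulInvariantMeasure.measure_preimage_smul g hB⟩
  have hcard : (Fintype.card (Isotropic 𝓀[F]) : ℝ) = (Nat.card 𝓀[F] : ℝ) ^ 4 - 1 := by
    have : Nat.card (Isotropic 𝓀[F]) + 1 = _ :=
      card_ne_zero_and (P := fun x : Fin 5 → 𝓀[F] => Q x x = 0) (by simp [Q_apply])
    rw [card_isotropic h2, Nat.card_eq_fintype_card] at this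
    rw [eq_sub_iff_add_eq]
    exact_mod_cast this
  have hq1 : 1 ≤ Nat.card 𝓀[F] := Nat.card_pos
  have hsum : (Fintype.card (Isotropic 𝓀[F]) : ℝ) * μ.real B =
      ∑ x : Isotropic 𝓀[F],
        ∫ v, (adjacentBall ϖ (c : F) r x.1).indicator (fun _ => (1 : ℝ)) v ∂μ := by
    simp only [fun x => integral_indicator_const (μ := μ) (1 : ℝ) (hadj x).1, Measure.real,
      fun x => (hadj x).2]
    simp
  have hint {s : Set (sphere (c : F))} (hs : MeasurableSet s) (hf : μ s ≠ ⊤) (t : ℝ) :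
      Integrable (s.indicator fun _ => t) μ := by
    rw [integrable_indicator_iff hs]
    exact integrableOn_const hf
  rw [← integral_finsetSum _ fun x _ => hint (hadj x).1 ((hadj x).2 ▸ hfB) 1] at hsum
  have hpt (v : sphere (c : F)) :
      (∑ x : Isotropic 𝓀[F], (adjacentBall ϖ (c : F) r x.1).indicator (fun _ => (1 : ℝ)) v) =
        P.indicator (fun _ => (Nat.card 𝓀[F] : ℝ) ^ 4 - 1) v + S.indicator (fun _ => (N : ℝ)) v +
          S'.indicator (fun _ => (Nat.card 𝓀[F] : ℝ) - 1) v := by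
    have hc := congrArg (Nat.cast (R := ℝ)) (card_mem_adjacentBall h0 hϖ h2 c r N hN v)
    rw [Nat.card_eq_fintype_card, Fintype.card_subtype, Finset.card_filter] at hc
    simp only [Set.indicator_apply] at hc ⊢
    push_cast [Nat.cast_sub hq1, Nat.cast_sub (Nat.one_le_pow 4 _ hq1)] at hc
    exact hc
  simp only [hpt] at hsum
  have hPS : Integrable (fun v => P.indicator (fun _ => (Nat.card 𝓀[F] : ℝ) ^ 4 - 1) v +
      S.indicator (fun _ => (N : ℝ)) v) μ := (hint hP hfP _).add (hint hS hfS _)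
  rw [integral_add hPS (hint hS' hfS' _),
    integral_add (hint hP hfP _) (hint hS hfS _), integral_indicator_const _ hP,
    integral_indicator_const _ hS, integral_indicator_const _ hS', hcard, ← hu1,
    measureReal_union hd1 hS] at hsum
  simp only [smul_eq_mul] at hsum
  linear_combination -hsum

end LocalField

section Volume

variable {F : Type*} [Field F] [ValuativeRel F]

theorem orbit_eq_shell_pow (ϖ : 𝒪[F]) (hϖ : Irreducible ϖ) {h : 𝒪[F]} (h2 : 2 * h = 1) {c : F}
    {v : sphere c} {a b : 𝒪[F]} (hv : v.1 = emb ![a, 0, 0, b, 1]) (r : ℕ) :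
    orbit ϖ hϖ v r = shell c ((ϖ : F) ^ r) := by
  have h0' : (ϖ : F) ≠ 0 := fun h => hϖ.ne_zero (Subtype.ext h)
  refine orbit_eq_shell h2 (pow_ne_zero r h0') ⟨![ϖ ^ r * ϖ ^ r * a, 0, 0, ϖ ^ r * b, 1], ?_, ?_⟩
  · change _ = (ϖ : F) ^ r • ((diagElt _).1.1 *ᵥ v.1)
    rw [hv, diagElt_mulVec]
    ext i
    fin_cases i <;> simp [emb, mul_assoc, h0']
  · exact red_ne_zero_iff.mpr ⟨4, isUnit_one⟩

variable [TopologicalSpace F] [IsNonarchimedeanLocalField F]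

/-- The volumes of the shells form a geometric progression from the first shell on. -/
theorem measure_shell_eq (h2 : (2 : 𝓀[F]) ≠ 0) {ϖ : 𝒪[F]} (hϖ : Irreducible ϖ) {c : F}
    {c₀ : 𝒪[F]} (hc : (c₀ : F) = c) (μ : Measure (sphere c)) [IsFiniteMeasureOnCompacts μ]
    [SMulInvariantMeasure (G F) (sphere c) μ] {N : ℕ}
    (hN : ∀ w : Fin 5 → 𝓀[F], Q w w = IsLocalRing.residue 𝒪[F] c₀ → w ≠ 0 →
      Nat.card {x : Fin 5 → 𝓀[F] // Q x x = 0 ∧ Q w x = 0} = N + 1)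
    {ρ : ℝ} (hρ0 : 0 ≤ ρ)
    (hρ : ((Nat.card 𝓀[F] : ℝ) - 1) * ((Nat.card 𝓀[F] : ℝ) ^ 3 * ρ) =
      (Nat.card 𝓀[F] : ℝ) ^ 4 - (N + 1)) {r : ℕ} (hr : 1 ≤ r) :
    μ (shell c ((ϖ : F) ^ r)) =
      ENNReal.ofReal ((Nat.card 𝓀[F] : ℝ) ^ (3 * r) * ρ) * μ (shell c ((ϖ : F) ^ 0)) := by
  subst hc
  have h0' : (ϖ : F) ≠ 0 := fun h => hϖ.ne_zero (Subtype.ext h)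
  have hdvd (a : 𝒪[F]) : ϖ ∣ a ↔ ¬ IsUnit a := by
    rw [← Ideal.mem_span_singleton, ← hϖ.maximalIdeal_eq, IsLocalRing.mem_maximalIdeal,
      mem_nonunits_iff]
  have hq : (1 : ℝ) < Nat.card 𝓀[F] := by exact_mod_cast Finite.one_lt_card
  set q : ℝ := ((Nat.card 𝓀[F] : ℕ) : ℝ)
  have hreal : μ.real (shell (c₀ : F) ((ϖ : F) ^ r)) =
      q ^ (3 * r) * ρ * μ.real (shell (c₀ : F) ((ϖ : F) ^ 0)) := by
    induction r, hr using Nat.le_induction with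
    | base =>
      have h := measure_shell_succ μ hϖ.ne_zero hdvd h2 0 N fun w hw hQ => by
        refine hN _ ?_ hw
        rw [Q_red, hQ, pow_zero, one_pow, one_mul]
      rw [← hρ, mul_assoc] at h
      exact mul_left_cancel₀ (sub_ne_zero.mpr hq.ne') h
    | succ r hr ih =>
      obtain ⟨M, hM⟩ : ∃ M, Nat.card 𝓀[F] ^ 3 = M + 1 :=
        Nat.exists_eq_add_of_le' (Nat.one_le_pow _ _ Nat.card_pos)
      have h := measure_shell_succ μ hϖ.ne_zero hdvd h2 r M fun w hw hQ => by
        rw [← hM]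
        refine card_isotropic_orthogonal_of_isotropic h2 hw ?_
        rw [Q_red, hQ, map_mul, map_pow, map_pow,
          (IsLocalRing.residue_eq_zero_iff ϖ).mpr
            ((IsLocalRing.mem_maximalIdeal _).mpr hϖ.not_isUnit)]
        simp [show r ≠ 0 by lia]
      have hM' : q ^ 3 = M + 1 := by simpa using congrArg (Nat.cast (R := ℝ)) hM
      refine mul_left_cancel₀ (sub_ne_zero.mpr hq.ne') (h.trans ?_)
      rw [ih, ← hM']
      ring
  rw [← ofReal_measureReal (measure_shell_ne_top (pow_ne_zero r h0') _ μ), hreal,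
    ENNReal.ofReal_mul (by positivity),
    ofReal_measureReal (measure_shell_ne_top (pow_ne_zero 0 h0') _ μ)]

end Volume

end SO32

theorem proposition1p8 {F : Type*} [Field F] [ValuativeRel F] [TopologicalSpace F]
    [IsNonarchimedeanLocalField F] (hF : ringChar 𝓀[F] ≠ 2)
    (ϖ : 𝒪[F]) (hϖ : Irreducible ϖ) :
    -- the split case
    (∀ (μ : Measure (SO32.sphere (1 : F))) [IsFiniteMeasureOnCompacts μ]
        [SMulInvariantMeasure (SO32.G F) (SO32.sphere (1 : F)) μ] (r : ℕ), 1 ≤ r →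
      μ (SO32.orbit ϖ hϖ (SO32.v₁Split (SO32.two_ne_zero_of_residue hF)) r) =
        ENNReal.ofReal ((Nat.card 𝓀[F] : ℝ) ^ (3 * r) * (1 - ((Nat.card 𝓀[F] : ℝ) ^ 2)⁻¹)) *
          μ (SO32.orbit ϖ hϖ (SO32.v₁Split (SO32.two_ne_zero_of_residue hF)) 0)) ∧
    -- the non-split case
    (∀ θ : 𝒪[F]ˣ, ¬ IsSquare ((θ : 𝒪[F]) : F) →
      ∀ (μ : Measure (SO32.sphere (4 * ((θ : 𝒪[F]) : F)))) [IsFiniteMeasureOnCompacts μ]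
        [SMulInvariantMeasure (SO32.G F) (SO32.sphere (4 * ((θ : 𝒪[F]) : F))) μ] (r : ℕ), 1 ≤ r →
      μ (SO32.orbit ϖ hϖ (SO32.v₁NonSplit ((θ : 𝒪[F]) : F)) r) =
        ENNReal.ofReal ((Nat.card 𝓀[F] : ℝ) ^ (3 * r) * (1 + ((Nat.card 𝓀[F] : ℝ) ^ 2)⁻¹)) *
          μ (SO32.orbit ϖ hϖ (SO32.v₁NonSplit ((θ : 𝒪[F]) : F)) 0)) := by
  have h2 : (2 : 𝓀[F]) ≠ 0 := Ring.two_ne_zero hF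
  have hunit : IsUnit (2 : 𝒪[F]) := by
    rw [← IsLocalRing.residue_ne_zero_iff_isUnit, map_ofNat]
    exact h2
  obtain ⟨h, hh⟩ := isUnit_iff_exists_inv.mp hunit
  have hq : 1 < Nat.card 𝓀[F] := Finite.one_lt_card
  have hq' : (1 : ℝ) < Nat.card 𝓀[F] := by exact_mod_cast hq
  have hq0 : (Nat.card 𝓀[F] : ℝ) ≠ 0 := by positivity
  constructor
  · intro μ _ _ r hr
    have hv : (SO32.v₁Split (SO32.two_ne_zero_of_residue hF)).1 = SO32.emb ![h, 0, 0, 0, 1] := by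
      have hhF : (2 : F) * h = 1 := congrArg Subtype.val hh
      ext i
      fin_cases i <;> simp [SO32.v₁Split, SO32.emb]
      exact inv_eq_of_mul_eq_one_right hhF
    rw [SO32.orbit_eq_shell_pow ϖ hϖ hh hv, SO32.orbit_eq_shell_pow ϖ hϖ hh hv]
    obtain ⟨N, hN⟩ : ∃ N, Nat.card 𝓀[F] ^ 3 + Nat.card 𝓀[F] ^ 2 = N + 1 + Nat.card 𝓀[F] :=
      ⟨Nat.card 𝓀[F] ^ 3 + Nat.card 𝓀[F] ^ 2 - 1 - Nat.card 𝓀[F], by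
        have h3 := Nat.one_le_pow 3 _ (zero_lt_one.trans hq)
        have h4 := Nat.le_self_pow two_ne_zero (Nat.card 𝓀[F])
        lia⟩
    refine SO32.measure_shell_eq h2 hϖ (c₀ := 1) rfl μ (N := N) (fun w hw _ => ?_) ?_ ?_ hr
    · have := SO32.card_isotropic_orthogonal_of_isSquare h2 (w := w)
        (by simp [hw]) (by simp [hw])
      lia
    · rw [sub_nonneg]
      exact inv_le_one_of_one_le₀ (one_le_pow₀ hq'.le)
    · have hN' : (Nat.card 𝓀[F] : ℝ) ^ 3 + (Nat.card 𝓀[F] : ℝ) ^ 2 = N + 1 + Nat.card 𝓀[F] := by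
        exact_mod_cast hN
      field_simp
      linear_combination -hN'
  · intro θ hθ μ _ _ r hr
    have hv : (SO32.v₁NonSplit ((θ : 𝒪[F]) : F)).1 = SO32.emb ![2 * (θ : 𝒪[F]), 0, 0, 1, 1] := by
      ext i
      fin_cases i <;> simp [SO32.v₁NonSplit, SO32.emb]
      rfl
    rw [SO32.orbit_eq_shell_pow ϖ hϖ hh hv, SO32.orbit_eq_shell_pow ϖ hϖ hh hv]
    obtain ⟨N, hN⟩ : ∃ N, Nat.card 𝓀[F] ^ 3 + Nat.card 𝓀[F] = N + 1 + Nat.card 𝓀[F] ^ 2 :=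
      ⟨Nat.card 𝓀[F] ^ 3 + Nat.card 𝓀[F] - 1 - Nat.card 𝓀[F] ^ 2, by
        have h3 := Nat.pow_le_pow_right (zero_lt_one.trans hq) (show 2 ≤ 3 by simp)
        lia⟩
    have hns : ¬ IsSquare (IsLocalRing.residue 𝒪[F] (4 * (θ : 𝒪[F]))) := by
      rintro ⟨s, hs⟩
      obtain ⟨b, hb⟩ := SO32.isSquare_of_isSquare_residue h2 (a := (θ : 𝒪[F]))
        ((IsLocalRing.residue_ne_zero_iff_isUnit _).mpr θ.isUnit)
        ⟨s / 2, by
          rw [map_mul, map_ofNat] at hs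
          field_simp
          linear_combination hs⟩
      exact hθ ⟨b, congrArg Subtype.val hb⟩
    refine SO32.measure_shell_eq h2 hϖ (c₀ := 4 * (θ : 𝒪[F])) rfl μ (N := N)
      (fun w hw _ => ?_) ?_ ?_ hr
    · have := SO32.card_isotropic_orthogonal_of_not_isSquare h2 (w := w) (by rwa [hw])
      lia
    · positivity
    · have hN' : (Nat.card 𝓀[F] : ℝ) ^ 3 + Nat.card 𝓀[F] = N + 1 + (Nat.card 𝓀[F] : ℝ) ^ 2 := by
        exact_mod_cast hN
      field_simp
      linear_combination -hN'
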